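/- Let $k$ be any field and let $n\ge 3$ be an odd integer. Let $D_n=\langle \sigma,\tau : \sigma^n=\tau^2=1,\ \tau\sigma\tau^{-1}=\sigma^{-1}\rangle$ be the dihedral group of order $2n$, acting on the rational function field $k(x_1,\dots,x_{n-1})$ by the $k$-automorphisms $$\sigma: x_1\mapsto x_2\mapsto\cdots\mapsto x_{n-1}\mapsto \frac{1}{x_1x_2\cdots x_{n-1}},\qquad \tau: x_i\mapsto x_{n-i}\quad(1\le i\le n-1).$$ Let $k(D_n)$ denote the fixed field $k(x_g : g\in D_n)^{D_n}$ of the rational function field in the $2n$ variables $x_g$ ($g\in D_n$), on which $D_n$ acts by the $k$-automorphisms determined by $h\cdot x_g=x_{hg}$ for $h,g\in D_n$. Call a field extension $L$ of $k$ stably $k$-rational if, for some integers $r,m\ge 0$, the rational function field $L(y_1,\dots,y_r)$ is $k$-isomorphic to the rational function field $k(z_1,\dots,z_m)$. Then the fixed field $k(x_1,\dots,x_{n-1})^{D_n}$ is stably $k$-rational if and only if $k(D_n)$ is stably $k$-rational. -/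

import Mathlib

/-! ### Rational function fields, rationality and stable rationality -/

/-- The field `k(x_i : i ∈ ι)` of rational functions over `k` in variables indexed by `ι`. -/
abbrev RationalFunctionField (ι : Type*) (k : Type*) [Field k] : Type _ :=
  FractionRing (MvPolynomial ι k)

/-- The variable `x_i` of the field `k(x_i : i ∈ ι)`. -/
noncomputable def ratVar {ι : Type*} (k : Type*) [Field k] (i : ι) : RationalFunctionField ι k :=
  algebraMap (MvPolynomial ι k) (RationalFunctionField ι k) (MvPolynomial.X i)

/-- A field extension `L` of `k` is `k`-rational if, for some natural number `m`, it is isomorphic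
over `k` to the rational function field in `m` variables over `k`. -/
def IsRationalField (k L : Type*) [Field k] [Field L] [Algebra k L] : Prop :=
  ∃ m : ℕ, Nonempty (L ≃ₐ[k] RationalFunctionField (Fin m) k)

/-- A field extension `L` of `k` is stably `k`-rational if, for some natural number `m`, the
rational function field `L(y_1, …, y_m)` is `k`-rational. -/
def IsStablyRationalField (k L : Type*) [Field k] [Field L] [Algebra k L] : Prop :=
  ∃ m : ℕ, IsRationalField k (RationalFunctionField (Fin m) L)

/-! ### The field `k(G) = k(x_g : g ∈ G)^G` of Noether's problem -/

/-- The action of `G` on `k(x_g : g ∈ G)` by `k`-automorphisms with `h • x_g = x_{hg}`. -/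
noncomputable def noetherAction (k : Type*) [Field k] (G : Type*) [Group G] :
    G →* (RationalFunctionField G k ≃ₐ[k] RationalFunctionField G k) :=
  (IsFractionRing.fieldEquivOfAlgEquivHom (A := k) (B := MvPolynomial G k) k
    (RationalFunctionField G k)).comp
  { toFun := fun h => MvPolynomial.renameEquiv k (Equiv.mulLeft h)
    map_one' := by
      apply AlgEquiv.ext; intro p
      simp
    map_mul' := fun a b => by
      apply AlgEquiv.ext; intro p
      simp [MvPolynomial.rename_rename, Function.comp_def] }

theorem noetherAction_apply_var (k : Type*) [Field k] {G : Type*} [Group G] (h g : G) :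
    noetherAction k G h (ratVar k g) = ratVar k (h * g) := by
  simp [noetherAction, ratVar]

/-- The field `k(G) = k(x_g : g ∈ G)^G`. -/
noncomputable def noetherField (k : Type*) [Field k] (G : Type*) [Group G] :
    IntermediateField k (RationalFunctionField G k) :=
  IntermediateField.fixedField (noetherAction k G).range

/-! ### The monomial action of the dihedral group on `k(x_1, …, x_{n-1})` -/

/-- The field `k(x_1, …, x_{n-1})`, whose variables are indexed by the nonzero residues
`1, …, n - 1` modulo `n`. -/
abbrev DihedralFunctionField (n : ℕ) (k : Type*) [Field k] : Type _ :=
  RationalFunctionField {i : ZMod n // i ≠ 0} k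

/-- The family `(x_i)` indexed by all residues modulo `n`: for `i ≠ 0` this is the variable `x_i`,
and `x_0 = x_n` stands for `1 / (x_1 ⋯ x_{n-1})`. -/
noncomputable def dihedralVar (n : ℕ) [NeZero n] (k : Type*) [Field k] (i : ZMod n) :
    DihedralFunctionField n k :=
  if h : i ≠ 0 then ratVar k ⟨i, h⟩ else (∏ j : {j : ZMod n // j ≠ 0}, ratVar k j)⁻¹

section dihedral

variable (n : ℕ) [NeZero n] (k : Type*) [Field k]

theorem ratVar_ne_zero {ι : Type*} (i : ι) : ratVar k i ≠ 0 := by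
  simp [ratVar]

theorem dihedralVar_of_ne (i : {i : ZMod n // i ≠ 0}) :
    dihedralVar n k (i : ZMod n) = ratVar k i := by
  simp [dihedralVar, i.2]

theorem dihedralVar_zero :
    dihedralVar n k 0 = (∏ j : {j : ZMod n // j ≠ 0}, ratVar k j)⁻¹ := by
  simp [dihedralVar]

theorem dihedralVar_ne_zero (i : ZMod n) : dihedralVar n k i ≠ 0 := by
  by_cases h : i = 0
  · subst h
    rw [dihedralVar_zero]
    exact inv_ne_zero (Finset.prod_ne_zero_iff.2 fun j _ => ratVar_ne_zero k j)
  · rw [dihedralVar_of_ne n k ⟨i, h⟩]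
    exact ratVar_ne_zero k _

theorem prod_dihedralVar : ∏ i : ZMod n, dihedralVar n k i = 1 := by
  rw [Fintype.prod_eq_mul_prod_subtype_ne _ (0 : ZMod n), dihedralVar_zero]
  simp only [dihedralVar_of_ne]
  exact inv_mul_cancel₀ (Finset.prod_ne_zero_iff.2 fun j _ => ratVar_ne_zero k j)

theorem dihedralVar_perm_zero (e : Equiv.Perm (ZMod n)) :
    dihedralVar n k (e 0) =
      (∏ j : {j : ZMod n // j ≠ 0}, dihedralVar n k (e (j : ZMod n)))⁻¹ := by
  have h : ∏ i : ZMod n, dihedralVar n k (e i) = 1 := by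
    rw [Equiv.prod_comp e (dihedralVar n k), prod_dihedralVar]
  rw [Fintype.prod_eq_mul_prod_subtype_ne _ (0 : ZMod n)] at h
  exact eq_inv_of_mul_eq_one_left h

theorem adjoin_ratVar (ι : Type*) :
    IntermediateField.adjoin k (Set.range (ratVar k : ι → RationalFunctionField ι k)) = ⊤ := by
  rw [eq_top_iff]
  intro z _
  have key : ∀ p : MvPolynomial ι k, algebraMap (MvPolynomial ι k) (RationalFunctionField ι k) p ∈
      IntermediateField.adjoin k (Set.range (ratVar k : ι → RationalFunctionField ι k)) := by
    intro p
    induction p using MvPolynomial.induction_on with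
    | C a =>
      rw [← MvPolynomial.algebraMap_eq, ← IsScalarTower.algebraMap_apply]
      exact IntermediateField.algebraMap_mem _ a
    | add p q hp hq => rw [map_add]; exact add_mem hp hq
    | mul_X p i hp =>
      rw [map_mul]
      exact mul_mem hp (IntermediateField.subset_adjoin _ _ ⟨i, rfl⟩)
  obtain ⟨a, b, -, rfl⟩ := IsFractionRing.div_surjective (MvPolynomial ι k) z
  exact div_mem (key a) (key b)

theorem algebraicIndependent_dihedralVar (e : Equiv.Perm (ZMod n)) :
    AlgebraicIndependent k
      (fun i : {i : ZMod n // i ≠ 0} => dihedralVar n k (e (i : ZMod n))) := by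
  set x : {i : ZMod n // i ≠ 0} → DihedralFunctionField n k :=
    fun i => dihedralVar n k (e (i : ZMod n)) with hx
  have hmem : ∀ i : ZMod n, dihedralVar n k (e i) ∈ IntermediateField.adjoin k (Set.range x) := by
    intro i
    by_cases h : i = 0
    · subst h
      rw [dihedralVar_perm_zero]
      exact inv_mem (prod_mem fun j _ => IntermediateField.subset_adjoin _ _ ⟨j, rfl⟩)
    · exact IntermediateField.subset_adjoin _ _ ⟨⟨i, h⟩, rfl⟩
  have htop : IntermediateField.adjoin k (Set.range x) = ⊤ := by
    rw [eq_top_iff, ← adjoin_ratVar, IntermediateField.adjoin_le_iff]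
    rintro _ ⟨i, rfl⟩
    have := hmem (e.symm i)
    rwa [e.apply_symm_apply, dihedralVar_of_ne] at this
  have halg : Algebra.IsAlgebraic (Algebra.adjoin k (Set.range x)) (DihedralFunctionField n k) := by
    refine ⟨fun z => ?_⟩
    have hz : z ∈ IntermediateField.adjoin k (Set.range x) := htop ▸ IntermediateField.mem_top
    obtain ⟨r, hr, s, hs, rfl⟩ := IntermediateField.mem_adjoin_iff_div.1 hz
    have h1 := isAlgebraic_algebraMap (A := DihedralFunctionField n k)
      (⟨r, hr⟩ : Algebra.adjoin k (Set.range x))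
    have h2 := isAlgebraic_algebraMap (A := DihedralFunctionField n k)
      (⟨s, hs⟩ : Algebra.adjoin k (Set.range x))
    rw [div_eq_mul_inv]
    exact h1.mul h2.inv
  refine (Algebra.IsAlgebraic.isTranscendenceBasis_of_lift_le_trdeg_of_finite k x ?_).1
  have hX : AlgebraicIndependent k (ratVar k : {i : ZMod n // i ≠ 0} → DihedralFunctionField n k) :=
    (MvPolynomial.algebraicIndependent_X _ _).map'
      (f := IsScalarTower.toAlgHom k (MvPolynomial {i : ZMod n // i ≠ 0} k)
        (DihedralFunctionField n k))
      (IsFractionRing.injective _ _)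
  exact hX.lift_cardinalMk_le_trdeg

/-- For a permutation `e` of the residues modulo `n`, the `k`-endomorphism `x_i ↦ x_{e(i)}`
of `k(x_1, …, x_{n-1})`. -/
noncomputable def permHom (e : Equiv.Perm (ZMod n)) :
    DihedralFunctionField n k →ₐ[k] DihedralFunctionField n k :=
  IsFractionRing.liftAlgHom
    (g := MvPolynomial.aeval
      (fun i : {i : ZMod n // i ≠ 0} => dihedralVar n k (e (i : ZMod n))))
    (algebraicIndependent_iff_injective_aeval.1 (algebraicIndependent_dihedralVar n k e))

theorem permHom_apply_var (e : Equiv.Perm (ZMod n)) (i : ZMod n) :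
    permHom n k e (dihedralVar n k i) = dihedralVar n k (e i) := by
  have key : ∀ j : {j : ZMod n // j ≠ 0},
      permHom n k e (ratVar k j) = dihedralVar n k (e (j : ZMod n)) := fun j => by
    rw [permHom, ratVar, IsFractionRing.liftAlgHom_apply, IsFractionRing.lift_algebraMap]
    simp
  by_cases h : i = 0
  · subst h
    rw [dihedralVar_zero, map_inv₀, map_prod, dihedralVar_perm_zero]
    simp only [key]
  · rw [← key ⟨i, h⟩, dihedralVar_of_ne n k ⟨i, h⟩]

variable {n k} in
theorem dihedralAlgHom_ext {f g : DihedralFunctionField n k →ₐ[k] DihedralFunctionField n k}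
    (h : ∀ i : ZMod n, f (dihedralVar n k i) = g (dihedralVar n k i)) : f = g := by
  apply IsLocalization.algHom_ext (nonZeroDivisors (MvPolynomial {i : ZMod n // i ≠ 0} k))
  apply MvPolynomial.algHom_ext
  intro i
  have := h i
  rw [dihedralVar_of_ne] at this
  exact this

/-- The action of the permutations of the residues modulo `n` on `k(x_1, …, x_{n-1})` by the
`k`-automorphisms `x_i ↦ x_{e(i)}`. -/
noncomputable def permAction :
    Equiv.Perm (ZMod n) →* (DihedralFunctionField n k ≃ₐ[k] DihedralFunctionField n k) where
  toFun e := AlgEquiv.ofAlgHom (permHom n k e) (permHom n k e⁻¹)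
    (dihedralAlgHom_ext fun i => by simp [permHom_apply_var])
    (dihedralAlgHom_ext fun i => by simp [permHom_apply_var])
  map_one' := by
    have h : permHom n k 1 = AlgHom.id k _ :=
      dihedralAlgHom_ext fun i => by simp [permHom_apply_var]
    apply AlgEquiv.ext; intro z
    simp [h]
  map_mul' a b := by
    have h : permHom n k (a * b) = (permHom n k a).comp (permHom n k b) :=
      dihedralAlgHom_ext fun i => by simp [permHom_apply_var]
    apply AlgEquiv.ext; intro z
    simp [h]

end dihedral

/-- The action of the dihedral group on the residues modulo `n`: the rotation `σ = r 1` acts as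
`i ↦ i + 1` and the reflection `τ = sr 0` as `i ↦ -i` (so `r j = σ ^ j` acts as `i ↦ i + j`, and
`sr j = τ σ ^ j` as `i ↦ -(i + j)`). -/
def dihedralPerm (n : ℕ) : DihedralGroup n →* Equiv.Perm (ZMod n) where
  toFun
    | .r j => Equiv.addRight j
    | .sr j => (Equiv.addRight j).trans (Equiv.neg (ZMod n))
  map_one' := by
    rw [DihedralGroup.one_def]
    ext i
    simp
  map_mul' := by
    rintro (a | a) (b | b) <;> apply Equiv.ext <;> intro i <;> simp <;> ring

/-- The action of `D_n = ⟨σ, τ⟩` on `k(x_1, …, x_{n-1})` by `k`-automorphisms with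
`σ : x_1 ↦ x_2 ↦ ⋯ ↦ x_{n-1} ↦ 1 / (x_1 ⋯ x_{n-1})` and `τ : x_i ↔ x_{n-i}`. -/
noncomputable def dihedralAction (n : ℕ) [NeZero n] (k : Type*) [Field k] :
    DihedralGroup n →* (DihedralFunctionField n k ≃ₐ[k] DihedralFunctionField n k) :=
  (permAction n k).comp (dihedralPerm n)

theorem dihedralAction_sigma (n : ℕ) [NeZero n] (k : Type*) [Field k]
    (i : {i : ZMod n // i ≠ 0}) (hi : (i : ZMod n) + 1 ≠ 0) :
    dihedralAction n k (.r 1) (ratVar k i) = ratVar k ⟨(i : ZMod n) + 1, hi⟩ := by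
  rw [← dihedralVar_of_ne, ← dihedralVar_of_ne]
  exact permHom_apply_var n k _ _

theorem dihedralAction_sigma_last (n : ℕ) [NeZero n] (k : Type*) [Field k]
    (i : {i : ZMod n // i ≠ 0}) (hi : (i : ZMod n) + 1 = 0) :
    dihedralAction n k (.r 1) (ratVar k i) = (∏ j : {j : ZMod n // j ≠ 0}, ratVar k j)⁻¹ := by
  rw [← dihedralVar_of_ne, ← dihedralVar_zero]
  refine (permHom_apply_var n k _ _).trans ?_
  simp [dihedralPerm, hi]

theorem dihedralAction_tau (n : ℕ) [NeZero n] (k : Type*) [Field k]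
    (i : {i : ZMod n // i ≠ 0}) :
    dihedralAction n k (.sr 0) (ratVar k i) = ratVar k ⟨-(i : ZMod n), neg_ne_zero.2 i.2⟩ := by
  rw [← dihedralVar_of_ne, ← dihedralVar_of_ne]
  refine (permHom_apply_var n k _ _).trans ?_
  simp [dihedralPerm]

/-- The fixed field `k(x_1, …, x_{n-1})^{D_n}`. -/
noncomputable def dihedralFixedField (n : ℕ) [NeZero n] (k : Type*) [Field k] :
    IntermediateField k (DihedralFunctionField n k) :=
  IntermediateField.fixedField (dihedralAction n k).range

/-!
Both fixed fields are compared with a third one. Let `D_n` act on `F = k(w_g : g ∈ D_n)(z)` by left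
translation on the `w_g`, fixing `z`.

The engine is the no-name lemma (`nonempty_algEquiv_fixedField`): if a finite group acts on `L`
faithfully, and on `E = L(t_1, …, t_r)`, purely transcendental over `L`, so that the `L`-span of the
`t_i` is stable, then `E^G` is purely transcendental over `L^G`. Galois descent
(`le_span_invariants`) replaces the `t_i` by invariant generators `u_i`; then `E` is spanned by `L`
over `L^G(u_1, …, u_r)`, and averaging over `G` against an element of `L` of trace `1` shows that
this field is all of `E^G`. No assumption on the characteristic is needed.

With `L = k(w_g)` and the single generator `z` the lemma gives `F^{D_n} = k(D_n)(z)`.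

With `L = k(x_1, …, x_{n-1})` it gives that `F^{D_n}` is purely transcendental over
`k(x_1, …, x_{n-1})^{D_n}`, once this field is embedded equivariantly into `F`. The embedding comes
from an exact sequence of `D_n`-lattices `0 → J → ℤ[D_n] ⊕ ℤ → ℤ[D_n/⟨τ⟩] ⊕ ℤ[D_n/⟨σ⟩] → 0`, where
`J` is the lattice of monomials in the `x_i`; this is where `n` odd is used. In terms of monomials:
with `n = 2m + 1`, `a_i = w_{σ^i}`, `b_i = w_{σ^i τ}` and `d_i = a_i / b_i`, one sends `x_i` to
`d_{i+m+1} / d_{i+m}` (`embVar`). The `n + 2` relative generators are the monomials `t_i`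
(`permVar`), which `D_n` permutes, and `a_0 / t_0`, `b_0 / t_0`, which it permutes up to factors from
`k(x_1, …, x_{n-1})` (`rotVar_div_permVar_succ`). All algebraic independence statements follow from
counting: `(n - 1) + (n + 2) = 2n + 1` elements generate `F`, which has transcendence degree
`2n + 1`.

Finally, stable rationality does not change under purely transcendental extensions
(`isStablyRationalField_ratFun_iff`).
-/

/-! ### Generators of rational function fields -/

theorem isAlgebraic_of_adjoin_range_eq_top {k E ι : Type*} [Field k] [Field E] [Algebra k E]
    {y : ι → E} (h : IntermediateField.adjoin k (Set.range y) = ⊤) :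
    Algebra.IsAlgebraic (Algebra.adjoin k (Set.range y)) E := by
  refine ⟨fun z => ?_⟩
  have hz : z ∈ IntermediateField.adjoin k (Set.range y) := h ▸ IntermediateField.mem_top
  obtain ⟨r, hr, s, hs, rfl⟩ := IntermediateField.mem_adjoin_iff_div.1 hz
  have h1 := isAlgebraic_algebraMap (A := E) (⟨r, hr⟩ : Algebra.adjoin k (Set.range y))
  have h2 := isAlgebraic_algebraMap (A := E) (⟨s, hs⟩ : Algebra.adjoin k (Set.range y))
  rw [div_eq_mul_inv]
  exact h1.mul h2.inv

/-- Generators of a field are algebraically independent if there are no more of them than the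
transcendence degree. -/
theorem algebraicIndependent_of_card_le_trdeg {k E ι : Type*} [Field k] [Field E] [Algebra k E]
    [Finite ι] {y : ι → E} (h : IntermediateField.adjoin k (Set.range y) = ⊤)
    (hc : (Nat.card ι : Cardinal) ≤ Algebra.trdeg k E) : AlgebraicIndependent k y := by
  have := isAlgebraic_of_adjoin_range_eq_top h
  refine (Algebra.IsAlgebraic.isTranscendenceBasis_of_lift_le_trdeg_of_finite k y ?_).1
  rw [← Nat.cast_card, Cardinal.lift_natCast]
  exact Cardinal.nat_le_lift_iff.2 hc

theorem algebraicIndependent_ratVar (ι k : Type*) [Field k] :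
    AlgebraicIndependent k (ratVar k : ι → RationalFunctionField ι k) :=
  (MvPolynomial.algebraicIndependent_X _ _).map'
    (f := IsScalarTower.toAlgHom k (MvPolynomial ι k) (RationalFunctionField ι k))
    (IsFractionRing.injective _ _)

theorem trdeg_rationalFunctionField (ι k : Type*) [Field k] [Finite ι] :
    Algebra.trdeg k (RationalFunctionField ι k) = Nat.card ι := by
  have := isAlgebraic_of_adjoin_range_eq_top (adjoin_ratVar k ι)
  have h := ((algebraicIndependent_ratVar ι k).isTranscendenceBasis_iff_isAlgebraic.2
    this).lift_cardinalMk_eq_trdeg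
  rw [← Nat.cast_card, Cardinal.lift_natCast] at h
  exact Cardinal.lift_eq_nat_iff.1 h.symm

theorem ratVar_algHom_ext {k E ι : Type*} [Field k] [Field E] [Algebra k E]
    {f g : RationalFunctionField ι k →ₐ[k] E} (h : ∀ i, f (ratVar k i) = g (ratVar k i)) :
    f = g := by
  apply IsLocalization.algHom_ext (nonZeroDivisors (MvPolynomial ι k))
  apply MvPolynomial.algHom_ext
  exact h

/-- The embedding `k(x_i : i ∈ ι) → E` that sends the variables to a given algebraically
independent family. -/
noncomputable def ratFunHom {k E ι : Type*} [Field k] [Field E] [Algebra k E] {y : ι → E}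
    (hy : AlgebraicIndependent k y) : RationalFunctionField ι k →ₐ[k] E :=
  IsFractionRing.liftAlgHom (g := MvPolynomial.aeval y)
    (algebraicIndependent_iff_injective_aeval.1 hy)

theorem ratFunHom_ratVar {k E ι : Type*} [Field k] [Field E] [Algebra k E] {y : ι → E}
    (hy : AlgebraicIndependent k y) (i : ι) : ratFunHom hy (ratVar k i) = y i := by
  rw [ratFunHom, ratVar, IsFractionRing.liftAlgHom_apply, IsFractionRing.lift_algebraMap]
  simp

/-- A field generated by an algebraically independent family is a rational function field. -/
noncomputable def ratFunEquiv {k E ι : Type*} [Field k] [Field E] [Algebra k E] {y : ι → E}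
    (hy : AlgebraicIndependent k y) (h : IntermediateField.adjoin k (Set.range y) = ⊤) :
    RationalFunctionField ι k ≃ₐ[k] E :=
  hy.aevalEquivField.trans
    ((IntermediateField.equivOfEq h).trans IntermediateField.topEquiv)

/-! ### Invariance of stable rationality -/

/-- `L(x_i : i ∈ ι)(y_j : j ∈ κ)` is the rational function field over `L` in the variables `x_i`
and `y_j`. -/
theorem nonempty_algEquiv_iterated (L ι κ : Type*) [Field L] :
    Nonempty (RationalFunctionField (κ ⊕ ι) L ≃ₐ[L]
      RationalFunctionField κ (RationalFunctionField ι L)) := by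
  refine ⟨ratFunEquiv ((algebraicIndependent_ratVar ι L).sumElim_comp
    (algebraicIndependent_ratVar κ (RationalFunctionField ι L))) ?_⟩
  set S := IntermediateField.adjoin L (Set.range (Sum.elim
    (ratVar (RationalFunctionField ι L) :
      κ → RationalFunctionField κ (RationalFunctionField ι L))
    (algebraMap (RationalFunctionField ι L) (RationalFunctionField κ (RationalFunctionField ι L)) ∘
      ratVar L))) with hS
  have hx : ∀ a : RationalFunctionField ι L, algebraMap _
      (RationalFunctionField κ (RationalFunctionField ι L)) a ∈ S := by
    intro a
    have ha : a ∈ IntermediateField.comap (IsScalarTower.toAlgHom L (RationalFunctionField ι L)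
        (RationalFunctionField κ (RationalFunctionField ι L))) S := by
      suffices h : (⊤ : IntermediateField L (RationalFunctionField ι L)) ≤ _ from h trivial
      rw [← adjoin_ratVar L ι, IntermediateField.adjoin_le_iff]
      rintro _ ⟨i, rfl⟩
      exact IntermediateField.subset_adjoin _ _ ⟨.inr i, rfl⟩
    exact ha
  rw [eq_top_iff]
  intro z _
  have hz : z ∈ IntermediateField.adjoin (RationalFunctionField ι L) (Set.range
      (ratVar (RationalFunctionField ι L) :
        κ → RationalFunctionField κ (RationalFunctionField ι L))) :=
    adjoin_ratVar (RationalFunctionField ι L) κ ▸ trivial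
  induction hz using IntermediateField.adjoin_induction with
  | mem x hx =>
    obtain ⟨i, rfl⟩ := hx
    exact IntermediateField.subset_adjoin _ _ ⟨.inl i, rfl⟩
  | algebraMap x => exact hx x
  | add x y _ _ h1 h2 => exact add_mem (h1 trivial) (h2 trivial)
  | inv x _ h => exact inv_mem (h trivial)
  | mul x y _ _ h1 h2 => exact mul_mem (h1 trivial) (h2 trivial)

theorem nonempty_algEquiv_reindex {ι κ : Type*} (e : ι ≃ κ) (k : Type*) [Field k] :
    Nonempty (RationalFunctionField ι k ≃ₐ[k] RationalFunctionField κ k) :=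
  ⟨IsFractionRing.algEquivOfAlgEquiv (MvPolynomial.renameEquiv k e)⟩

theorem nonempty_algEquiv_congr {k L L' : Type*} [Field k] [Field L] [Field L'] [Algebra k L]
    [Algebra k L'] (ι : Type*) (e : L ≃ₐ[k] L') :
    Nonempty (RationalFunctionField ι L ≃ₐ[k] RationalFunctionField ι L') :=
  ⟨IsFractionRing.algEquivOfAlgEquiv (MvPolynomial.mapAlgEquiv ι e)⟩

theorem nonempty_algEquiv_iterated_fin (k : Type*) {L : Type*} [Field k] [Field L] [Algebra k L]
    (a b : ℕ) : Nonempty (RationalFunctionField (Fin b) (RationalFunctionField (Fin a) L) ≃ₐ[k]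
      RationalFunctionField (Fin (b + a)) L) := by
  obtain ⟨e⟩ := nonempty_algEquiv_iterated L (Fin a) (Fin b)
  obtain ⟨f⟩ := nonempty_algEquiv_reindex (finSumFinEquiv (m := b) (n := a)) L
  exact ⟨(e.symm.trans f).restrictScalars k⟩

theorem IsStablyRationalField.of_algEquiv {k L L' : Type*} [Field k] [Field L] [Field L']
    [Algebra k L] [Algebra k L'] (e : L ≃ₐ[k] L') (h : IsStablyRationalField k L) :
    IsStablyRationalField k L' := by
  obtain ⟨m, r, ⟨f⟩⟩ := h
  obtain ⟨g⟩ := nonempty_algEquiv_congr (Fin m) e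
  exact ⟨m, r, ⟨g.symm.trans f⟩⟩

theorem isStablyRationalField_ratFun_iff {k L ι : Type*} [Field k] [Field L] [Algebra k L]
    [Finite ι] :
    IsStablyRationalField k (RationalFunctionField ι L) ↔ IsStablyRationalField k L := by
  obtain ⟨a, ⟨eι⟩⟩ := Finite.exists_equiv_fin ι
  obtain ⟨e⟩ := nonempty_algEquiv_reindex eι L
  have e := e.restrictScalars k
  constructor
  · intro h
    obtain ⟨m, r, ⟨f⟩⟩ := h.of_algEquiv e
    obtain ⟨g⟩ := nonempty_algEquiv_iterated_fin k (L := L) a m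
    exact ⟨m + a, r, ⟨g.symm.trans f⟩⟩
  · rintro ⟨m, r, ⟨f⟩⟩
    refine IsStablyRationalField.of_algEquiv e.symm ⟨m, a + r, ?_⟩
    obtain ⟨g₁⟩ := nonempty_algEquiv_iterated_fin k (L := L) a m
    obtain ⟨g₂⟩ := nonempty_algEquiv_reindex (finCongr (Nat.add_comm m a)) L
    obtain ⟨g₃⟩ := nonempty_algEquiv_iterated_fin k (L := L) m a
    obtain ⟨g₄⟩ := nonempty_algEquiv_congr (Fin a) f
    obtain ⟨g₅⟩ := nonempty_algEquiv_iterated_fin k (L := k) r a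
    exact ⟨g₁.trans ((g₂.restrictScalars k).trans (g₃.symm.trans (g₄.trans g₅)))⟩

/-! ### Galois descent and the no-name lemma -/

section NoName

variable {k L E G : Type*} [Field k] [Field L] [Field E] [Algebra k L] [Algebra k E] [Algebra L E]
  [Group G] [Fintype G]

/-- By Dedekind's independence of characters, the twisted traces `∑ g, g(a) * w g` detect the
vanishing of a family `w` indexed by a group acting faithfully on `L`. -/
theorem eq_zero_of_forall_sum_smul_eq_zero {ρ : G →* (L ≃ₐ[k] L)}
    (hρ : Function.Injective ρ) {w : G → L} (h : ∀ a : L, ∑ g, ρ g a * w g = 0) (g : G) :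
    w g = 0 := by
  have hli : LinearIndependent L (fun g : G => ((ρ g : L →* L) : L → L)) :=
    (linearIndependent_monoidHom L L).comp (fun g : G => (ρ g : L →* L)) fun a b hab =>
      hρ (AlgEquiv.ext fun x => DFunLike.congr_fun hab x)
  refine Fintype.linearIndependent_iff.1 hli w (funext fun a => ?_) g
  rw [Finset.sum_apply]
  simpa [mul_comm] using h a

theorem apply_sum_apply (θ : G →* (L ≃ₐ[k] L)) (h : G) (x : L) :
    θ h (∑ g, θ g x) = ∑ g, θ g x := by
  rw [map_sum]
  conv_rhs => rw [← Equiv.sum_comp (Equiv.mulLeft h)]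
  simp

/-- The trace `∑ g, g(a)` takes the value `1`, in every characteristic. -/
theorem exists_sum_apply_eq_one {ρ : G →* (L ≃ₐ[k] L)} (hρ : Function.Injective ρ) :
    ∃ a : L, ∑ g, ρ g a = 1 := by
  obtain ⟨b, hb⟩ : ∃ b : L, ∑ g, ρ g b ≠ 0 := by
    by_contra! h
    exact one_ne_zero (eq_zero_of_forall_sum_smul_eq_zero hρ (w := fun _ => 1) (by simpa using h) 1)
  refine ⟨b * (∑ g, ρ g b)⁻¹, ?_⟩
  simp only [map_mul, map_inv₀, apply_sum_apply]
  rw [← Finset.sum_mul, mul_inv_cancel₀ hb]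

/-- Galois descent: a subspace of `E` stable under a semilinear action is spanned by its invariant
vectors. -/
theorem le_span_invariants {ρ : G →* (L ≃ₐ[k] L)} (hρ : Function.Injective ρ)
    {θ : G →* (E ≃ₐ[k] E)} (hθ : ∀ g a, θ g (algebraMap L E a) = algebraMap L E (ρ g a))
    {V : Submodule L E} (hV : ∀ g, ∀ v ∈ V, θ g v ∈ V) :
    V ≤ Submodule.span L {v | v ∈ V ∧ ∀ g, θ g v = v} := by
  intro v hv
  by_contra hvW
  -- a functional that kills all invariant vectors, in particular the twisted traces of `v`
  obtain ⟨f, hfv, hf⟩ := Submodule.exists_le_ker_of_notMem hvW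
  refine hfv ?_
  have key := eq_zero_of_forall_sum_smul_eq_zero hρ (w := fun g => f (θ g v)) (fun a => ?_) 1
  · simpa using key
  have hmem : ∑ g, θ g (a • v) ∈ {v | v ∈ V ∧ ∀ g, θ g v = v} := by
    exact ⟨sum_mem fun g _ => hV g _ (V.smul_mem a hv), fun h => apply_sum_apply θ h _⟩
  have hsmul : ∀ g, θ g (a • v) = ρ g a • θ g v := fun g => by
    rw [Algebra.smul_def, map_mul, hθ, ← Algebra.smul_def]
  simpa [hsmul] using LinearMap.mem_ker.1 (hf (Submodule.subset_span hmem))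

theorem isAlgebraic_fixedField (ρ : G →* (L ≃ₐ[k] L)) :
    Algebra.IsAlgebraic (IntermediateField.fixedField ρ.range) L := by
  have : Algebra.IsInvariant (IntermediateField.fixedField ρ.range) L ρ.range :=
    ⟨fun b hb =>
      ⟨⟨b, (IntermediateField.mem_fixedField_iff _ _).2 fun f hf => hb ⟨f, hf⟩⟩, rfl⟩⟩
  have : Finite ρ.range := Finite.of_surjective _ ρ.rangeRestrict_surjective
  have := Algebra.IsInvariant.isIntegral (IntermediateField.fixedField ρ.range) L ρ.range
  infer_instance

/-- If `L` consists of elements algebraic over `F` and `E = F(L)`, then `L` spans `E` over `F`. -/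
theorem mem_span_range_algebraMap {F : Type*} [Field F] [Algebra F E]
    (halg : ∀ a : L, IsAlgebraic F (algebraMap L E a))
    (htop : IntermediateField.adjoin F (Set.range (algebraMap L E)) = ⊤) (e : E) :
    e ∈ Submodule.span F (Set.range (algebraMap L E)) := by
  have h1 := IntermediateField.adjoin_toSubalgebra_of_isAlgebraic (F := F)
    (S := Set.range (algebraMap L E)) (by rintro _ ⟨a, rfl⟩; exact halg a)
  rw [htop] at h1
  have h2 := Algebra.adjoin_eq_span F (Set.range (algebraMap L E))
  have h3 : Submonoid.closure (Set.range (algebraMap L E)) =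
      MonoidHom.mrange (algebraMap L E : L →* E) := by
    rw [← Submonoid.closure_eq (MonoidHom.mrange (algebraMap L E : L →* E)),
      MonoidHom.coe_mrange]
    rfl
  rw [← h1, h3] at h2
  have h4 : e ∈ Submodule.span F (MonoidHom.mrange (algebraMap L E : L →* E) : Set E) :=
    h2 ▸ Submodule.mem_top
  exact h4

/-- The given basis of a stable subspace may be replaced by one of invariant vectors, with the same
index set. -/
theorem exists_invariant_basis {ι : Type*} [Finite ι] [IsScalarTower k L E]
    {ρ : G →* (L ≃ₐ[k] L)} (hρ : Function.Injective ρ)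
    {θ : G →* (E ≃ₐ[k] E)} (hθ : ∀ g a, θ g (algebraMap L E a) = algebraMap L E (ρ g a))
    {t : ι → E} (ht : LinearIndependent L t)
    (hstab : ∀ g i, θ g (t i) ∈ Submodule.span L (Set.range t)) :
    ∃ u : ι → E, (∀ g i, θ g (u i) = u i) ∧
      Set.range t ⊆ Submodule.span L (Set.range u) := by
  set V := Submodule.span L (Set.range t) with hVdef
  have hV : ∀ g, ∀ v ∈ V, θ g v ∈ V := by
    intro g v hv
    induction hv using Submodule.span_induction with
    | mem x hx => obtain ⟨i, rfl⟩ := hx; exact hstab g i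
    | zero => simp
    | add x y _ _ hx hy => rw [map_add]; exact add_mem hx hy
    | smul a x _ hx =>
      rw [Algebra.smul_def, map_mul, hθ, ← Algebra.smul_def]
      exact V.smul_mem _ hx
  obtain ⟨κ, a, ha, hsp, hli⟩ := exists_linearIndependent' L
    (fun v : {v | v ∈ V ∧ ∀ g, θ g v = v} => (v : E))
  rw [Subtype.range_coe] at hsp
  have hVsp : V = Submodule.span L
      (Set.range ((fun v : {v | v ∈ V ∧ ∀ g, θ g v = v} => (v : E)) ∘ a)) := by
    refine le_antisymm ((le_span_invariants hρ hθ hV).trans hsp.ge) ?_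
    rw [Submodule.span_le]
    rintro _ ⟨i, rfl⟩
    exact (a i).2.1
  let b := (Module.Basis.span ht)
  let c := (Module.Basis.span hli).map (LinearEquiv.ofEq _ _ hVsp.symm)
  let e := b.indexEquiv c
  refine ⟨fun i => a (e i), fun g i => (a (e i)).2.2 g, ?_⟩
  have : Set.range (fun i => (a (e i) : E)) =
      Set.range ((fun v : {v | v ∈ V ∧ ∀ g, θ g v = v} => (v : E)) ∘ a) :=
    e.surjective.range_comp ((fun v : {v | v ∈ V ∧ ∀ g, θ g v = v} => (v : E)) ∘ a)
  rw [this, ← hVsp]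
  exact Submodule.subset_span

/-- The no-name lemma: if `E = L(t_i : i ∈ ι)` is purely transcendental over `L` and a finite group
acts compatibly on both fields, faithfully on `L` and linearly over `L` in the `t_i`, then `E^G` is
purely transcendental over `L^G`. -/
theorem nonempty_algEquiv_fixedField {ι : Type*} [Finite ι] [IsScalarTower k L E]
    {ρ : G →* (L ≃ₐ[k] L)} (hρ : Function.Injective ρ)
    {θ : G →* (E ≃ₐ[k] E)} (hθ : ∀ g a, θ g (algebraMap L E a) = algebraMap L E (ρ g a))
    {t : ι → E} (htop : IntermediateField.adjoin L (Set.range t) = ⊤)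
    (hcard : (Nat.card ι : Cardinal) ≤ Algebra.trdeg L E)
    (hstab : ∀ g i, θ g (t i) ∈ Submodule.span L (Set.range t)) :
    Nonempty (RationalFunctionField ι (IntermediateField.fixedField ρ.range) ≃ₐ[k]
      IntermediateField.fixedField θ.range) := by
  obtain ⟨u, hu, htu⟩ := exists_invariant_basis hρ hθ
    (algebraicIndependent_of_card_le_trdeg htop hcard).linearIndependent hstab
  have hutop : IntermediateField.adjoin L (Set.range u) = ⊤ := by
    rw [eq_top_iff, ← htop, IntermediateField.adjoin_le_iff]
    refine htu.trans ?_
    have : Submodule.span L (Set.range u) ≤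
        Subalgebra.toSubmodule (IntermediateField.adjoin L (Set.range u)).toSubalgebra :=
      Submodule.span_le.2 (IntermediateField.subset_adjoin L _)
    exact this
  set L₀ := IntermediateField.fixedField ρ.range with hL₀
  have hfix : ∀ (a : L₀) g, ρ g a = a := fun a g => a.2 ⟨ρ g, g, rfl⟩
  have hind : AlgebraicIndependent L₀ u :=
    (algebraicIndependent_of_card_le_trdeg hutop hcard).restrictScalars
      (algebraMap L₀ L).injective
  set F := IntermediateField.adjoin L₀ (Set.range u) with hF
  have hFfix : ∀ x ∈ F, ∀ g, θ g x = x := by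
    intro x hx g
    induction hx using IntermediateField.adjoin_induction with
    | mem x hx => obtain ⟨i, rfl⟩ := hx; exact hu g i
    | algebraMap x =>
      rw [IsScalarTower.algebraMap_apply L₀ L E, hθ]
      exact congrArg _ (hfix x g)
    | add x y _ _ h1 h2 => rw [map_add, h1, h2]
    | inv x _ h => rw [map_inv₀, h]
    | mul x y _ _ h1 h2 => rw [map_mul, h1, h2]
  have hspan : ∀ e : E, e ∈ Submodule.span F (Set.range (algebraMap L E)) := by
    refine mem_span_range_algebraMap (fun a => ?_) ?_
    · have := isAlgebraic_fixedField ρ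
      have h1 : IsAlgebraic L₀ a := Algebra.IsAlgebraic.isAlgebraic a
      exact (h1.algebraMap (A := E)).tower_top F
    · rw [eq_top_iff]
      intro z _
      have hz : z ∈ IntermediateField.adjoin L (Set.range u) := hutop ▸ trivial
      induction hz using IntermediateField.adjoin_induction with
      | mem x hx =>
        exact IntermediateField.algebraMap_mem _
          (⟨x, IntermediateField.subset_adjoin _ _ hx⟩ : F)
      | algebraMap x => exact IntermediateField.subset_adjoin _ _ ⟨x, rfl⟩
      | add x y _ _ h1 h2 => exact add_mem (h1 trivial) (h2 trivial)
      | inv x _ h => exact inv_mem (h trivial)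
      | mul x y _ _ h1 h2 => exact mul_mem (h1 trivial) (h2 trivial)
  -- the trace of any element of `E` lies in `F`, as `E` is spanned over `F` by `L`
  have htr : ∀ e : E, ∑ g, θ g e ∈ F := by
    intro e
    induction hspan e using Submodule.span_induction with
    | mem x hx =>
      obtain ⟨a, rfl⟩ := hx
      simp only [hθ, ← map_sum]
      have : ∑ g, ρ g a ∈ L₀ := by
        rintro ⟨_, h, rfl⟩
        exact apply_sum_apply ρ h a
      exact F.algebraMap_mem ⟨_, this⟩
    | zero => simp
    | add x y _ _ hx hy => simp only [map_add, Finset.sum_add_distrib]; exact add_mem hx hy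
    | smul c x _ hx =>
      have : ∀ g, θ g (c • x) = c * θ g x := fun g => by
        rw [Algebra.smul_def, map_mul]
        exact congrArg (· * _) (hFfix c c.2 g)
      simp only [this, ← Finset.mul_sum]
      exact mul_mem c.2 hx
  obtain ⟨a, ha⟩ := exists_sum_apply_eq_one hρ
  have hmem : ∀ x : E, x ∈ F ↔ x ∈ IntermediateField.fixedField θ.range := by
    refine fun x => ⟨fun hx => ?_, fun hx => ?_⟩
    · rintro ⟨_, g, rfl⟩
      exact hFfix x hx g
    · -- the trace of `a * x` is `x`, since `x` is invariant and `a` has trace `1`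
      have h1 := htr (algebraMap L E a * x)
      have h2 : ∀ g, θ g x = x := fun g => hx ⟨θ g, g, rfl⟩
      simpa only [map_mul, h2, hθ, ← Finset.sum_mul, ← map_sum, ha, map_one, one_mul] using h1
  have hFE : F.restrictScalars k = IntermediateField.fixedField θ.range :=
    IntermediateField.ext hmem
  exact ⟨(hind.aevalEquivField.restrictScalars k).trans
    (show F.restrictScalars k ≃ₐ[k] _ from IntermediateField.equivOfEq hFE)⟩

end NoName

/-- Form of the no-name lemma for an equivariant embedding `φ : L → E` and generators that are
permuted up to factors from `L`. -/
theorem nonempty_algEquiv_fixedField_of_monomial {k L E G ι : Type*} [Field k] [Field L] [Field E]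
    [Algebra k L] [Algebra k E] [Group G] [Finite G] [Finite ι] (φ : L →ₐ[k] E)
    {ρ : G →* (L ≃ₐ[k] L)} (hρ : Function.Injective ρ)
    {θ : G →* (E ≃ₐ[k] E)} (hθ : ∀ g a, θ g (φ a) = φ (ρ g a)) {t : ι → E}
    (htop : ∀ S : IntermediateField k E, (∀ a, φ a ∈ S) → (∀ i, t i ∈ S) → S = ⊤)
    {c : ℕ} (hL : Algebra.trdeg k L = c) (hE : Algebra.trdeg k E = (c + Nat.card ι : ℕ))
    (hstab : ∀ g i, ∃ a j, θ g (t i) = φ a * t j) :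
    Nonempty (RationalFunctionField ι (IntermediateField.fixedField ρ.range) ≃ₐ[k]
      IntermediateField.fixedField θ.range) := by
  cases nonempty_fintype G
  obtain ⟨_, hφ⟩ : ∃ _ : Algebra L E, ∀ a, algebraMap L E a = φ a :=
    ⟨φ.toRingHom.toAlgebra, fun _ => rfl⟩
  have : IsScalarTower k L E := IsScalarTower.of_algebraMap_eq fun x =>
    ((hφ _).trans (φ.commutes x)).symm
  refine nonempty_algEquiv_fixedField (t := t) hρ (fun g a => ?_) ?_ ?_ fun g i => ?_
  · rw [hφ, hφ, hθ]
  · set T := IntermediateField.adjoin L (Set.range t)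
    have h1 : ∀ a, φ a ∈ T.restrictScalars k := fun a => by
      rw [← hφ]
      exact T.algebraMap_mem a
    have h2 : ∀ i, t i ∈ T.restrictScalars k := fun i =>
      IntermediateField.subset_adjoin L _ ⟨i, rfl⟩
    exact IntermediateField.restrictScalars_eq_top_iff.1 (htop _ h1 h2)
  · have h := lift_trdeg_add_eq k L E
    rw [hL, hE, Cardinal.lift_natCast, Cardinal.lift_natCast, Nat.cast_add] at h
    exact Cardinal.nat_le_lift_iff.1
      (Cardinal.eq_of_add_eq_add_left h Cardinal.natCast_lt_aleph0).ge
  · obtain ⟨a, j, h⟩ := hstab g i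
    rw [h, ← hφ, ← Algebra.smul_def]
    exact Submodule.smul_mem _ a (Submodule.subset_span ⟨j, rfl⟩)

/-! ### The regular representation with one more invariant variable -/

/-- The action of `G` on `k(w_g : g ∈ G)(z)` with `h • w_g = w_{hg}` and `h • z = z`; the variable
`w_g` has index `some g` and `z` has index `none`. -/
noncomputable def extendedAction (k : Type*) [Field k] (G : Type*) [Group G] :
    G →* (RationalFunctionField (Option G) k ≃ₐ[k] RationalFunctionField (Option G) k) :=
  (IsFractionRing.fieldEquivOfAlgEquivHom (A := k) (B := MvPolynomial (Option G) k) k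
    (RationalFunctionField (Option G) k)).comp
  { toFun := fun h => MvPolynomial.renameEquiv k (MulAction.toPerm h)
    map_one' := by
      rw [← MulAction.toPermHom_apply, map_one]
      apply AlgEquiv.ext; intro p
      simp
    map_mul' := fun a b => by
      rw [← MulAction.toPermHom_apply, map_mul]
      apply AlgEquiv.ext; intro p
      simp [MvPolynomial.rename_rename, Function.comp_def] }

theorem extendedAction_apply_var (k : Type*) [Field k] {G : Type*} [Group G] (h : G)
    (i : Option G) : extendedAction k G h (ratVar k i) = ratVar k (h • i) := by
  simp [extendedAction, ratVar]

/-- `k(w_g, z)^G = k(G)(z)`. -/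
theorem nonempty_algEquiv_noetherField (k : Type*) [Field k] (G : Type*) [Group G] [Finite G] :
    Nonempty (RationalFunctionField Unit (noetherField k G) ≃ₐ[k]
      IntermediateField.fixedField (extendedAction k G).range) := by
  have hy : AlgebraicIndependent k (fun g : G => ratVar k (some g)) :=
    (algebraicIndependent_ratVar (Option G) k).comp _ (Option.some_injective G)
  refine nonempty_algEquiv_fixedField_of_monomial (ratFunHom hy) (ρ := noetherAction k G)
    (t := fun _ : Unit => ratVar k none) ?_ ?_ ?_ (trdeg_rationalFunctionField G k)
    ((trdeg_rationalFunctionField (Option G) k).trans (by simp)) ?_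
  · rw [injective_iff_map_eq_one]
    intro g hg
    have h := noetherAction_apply_var k g 1
    rw [hg, mul_one] at h
    exact ((algebraicIndependent_ratVar G k).injective h).symm
  · intro g a
    have : (extendedAction k G g : _ →ₐ[k] _).comp (ratFunHom hy) =
        (ratFunHom hy).comp (noetherAction k G g : _ →ₐ[k] _) :=
      ratVar_algHom_ext fun i => by
        simp [ratFunHom_ratVar, noetherAction_apply_var, extendedAction_apply_var]
    exact DFunLike.congr_fun this a
  · intro S h1 h2
    rw [eq_top_iff, ← adjoin_ratVar, IntermediateField.adjoin_le_iff]
    rintro _ ⟨_ | g, rfl⟩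
    · exact h2 ()
    · have := h1 (ratVar k g)
      rwa [ratFunHom_ratVar] at this
  · exact fun g i => ⟨1, (), by simp [extendedAction_apply_var]⟩

/-! ### The dihedral action is faithful -/

theorem dihedralVar_injective (n : ℕ) [NeZero n] (k : Type*) [Field k] :
    Function.Injective (dihedralVar n k) := by
  have key : ∀ i : ZMod n, i ≠ 0 → dihedralVar n k i ≠ dihedralVar n k 0 := by
    intro i hi h
    rw [dihedralVar_of_ne n k ⟨i, hi⟩, dihedralVar_zero] at h
    have h1 := mul_eq_one_iff_eq_inv₀
      (Finset.prod_ne_zero_iff.2 fun j _ => ratVar_ne_zero k j) |>.2 h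
    have h2 : (MvPolynomial.X ⟨i, hi⟩ * ∏ j : {j : ZMod n // j ≠ 0}, MvPolynomial.X j :
        MvPolynomial {j : ZMod n // j ≠ 0} k) = 1 := by
      apply IsFractionRing.injective (MvPolynomial {j : ZMod n // j ≠ 0} k)
        (DihedralFunctionField n k)
      rw [map_mul, map_prod, map_one]
      exact h1
    simpa using congrArg MvPolynomial.constantCoeff h2
  intro i j h
  by_cases hi : i = 0 <;> by_cases hj : j = 0
  · rw [hi, hj]
  · subst hi; exact absurd h.symm (key j hj)
  · subst hj; exact absurd h (key i hi)
  · rw [dihedralVar_of_ne n k ⟨i, hi⟩, dihedralVar_of_ne n k ⟨j, hj⟩] at h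
    exact congrArg Subtype.val ((algebraicIndependent_ratVar _ k).injective h)

theorem dihedralAction_injective {n : ℕ} [NeZero n] (hn : 3 ≤ n) (k : Type*) [Field k] :
    Function.Injective (dihedralAction n k) := by
  rw [injective_iff_map_eq_one]
  intro g hg
  have h : ∀ i, dihedralPerm n g i = i := fun i => dihedralVar_injective n k <| by
    rw [← permHom_apply_var n k (dihedralPerm n g) i]
    exact DFunLike.congr_fun hg (dihedralVar n k i)
  rcases g with c | c
  · have h0 : (0 : ZMod n) + c = 0 := h 0
    rw [zero_add] at h0
    rw [h0, DihedralGroup.one_def]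
  · exfalso
    have h0 : -((0 : ZMod n) + c) = 0 := h 0
    have h1 : -((1 : ZMod n) + c) = 1 := h 1
    -- fixing `0` and `1`, the reflection would force `2 = 0` modulo `n`
    have h2 : ((2 : ℕ) : ZMod n) = 0 := by push_cast; linear_combination h0 - h1
    have := Nat.le_of_dvd two_pos ((ZMod.natCast_eq_zero_iff 2 n).1 h2)
    omega

/-! ### The monomial embedding of `k(x_1, …, x_{n-1})` -/

section Embedding

variable (n : ℕ) (k : Type*) [Field k]

/-- The field `k(w_g : g ∈ D_n)(z)`. -/
abbrev ExtendedField (n : ℕ) (k : Type*) [Field k] : Type _ :=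
  RationalFunctionField (Option (DihedralGroup n)) k

/-- The variable `a_i = w_{σ^i}`. -/
noncomputable def rotVar (i : ZMod n) : ExtendedField n k := ratVar k (some (.r i))

/-- The variable `b_i = w_{σ^i τ}`; note that `σ^i τ = τ σ^{-i}`. -/
noncomputable def reflVar (i : ZMod n) : ExtendedField n k := ratVar k (some (.sr (-i)))

/-- The quotient `d_i = a_i / b_i`: rotations permute the `d_i` and reflections permute them up to
inversion. -/
noncomputable def quotVar (i : ZMod n) : ExtendedField n k := rotVar n k i / reflVar n k i

/-- The image `d_{i + m + 1} / d_{i + m}` of `x_i` in `k(w_g, z)`, for `n = 2 * m + 1`. Since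
`m + 1` is `1 / 2` modulo `n`, a reflection exchanges and inverts the two factors, so it permutes
these elements without inverting them. -/
noncomputable def embVar (m : ℕ) (i : ZMod n) : ExtendedField n k :=
  quotVar n k (i + m + 1) / quotVar n k (i + m)

/-- The monomial `t_i = z / ∏_{1 ≤ j ≤ m} a_{i+j} b_{i-j}`, for `n = 2 * m + 1`. The residues `i + j`
and `i - j` run through all residues other than `i` once, and a reflection exchanges the two kinds
of factors, so that `D_n` permutes the `t_i`. -/
noncomputable def permVar (m : ℕ) (i : ZMod n) : ExtendedField n k :=
  ratVar k none / ∏ j ∈ Finset.range m, (rotVar n k (i + (j + 1)) * reflVar n k (i - (j + 1)))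

theorem rotVar_ne_zero (i : ZMod n) : rotVar n k i ≠ 0 := ratVar_ne_zero k _

theorem reflVar_ne_zero (i : ZMod n) : reflVar n k i ≠ 0 := ratVar_ne_zero k _

theorem quotVar_ne_zero (i : ZMod n) : quotVar n k i ≠ 0 :=
  div_ne_zero (rotVar_ne_zero n k i) (reflVar_ne_zero n k i)

theorem prod_rotVar_mul_reflVar_ne_zero (m : ℕ) (i : ZMod n) :
    ∏ j ∈ Finset.range m, (rotVar n k (i + (j + 1)) * reflVar n k (i - (j + 1))) ≠ 0 :=
  Finset.prod_ne_zero_iff.2 fun _ _ => mul_ne_zero (rotVar_ne_zero n k _) (reflVar_ne_zero n k _)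

theorem permVar_ne_zero (m : ℕ) (i : ZMod n) : permVar n k m i ≠ 0 :=
  div_ne_zero (ratVar_ne_zero k _) (prod_rotVar_mul_reflVar_ne_zero n k m i)

theorem prod_embVar [NeZero n] (m : ℕ) : ∏ i, embVar n k m i = 1 := by
  simp only [embVar, Finset.prod_div_distrib]
  have h1 : ∏ i, quotVar n k (i + m) = ∏ i, quotVar n k i :=
    Equiv.prod_comp (Equiv.addRight (m : ZMod n)) (quotVar n k)
  have h2 : ∏ i, quotVar n k (i + m + 1) = ∏ i, quotVar n k i :=
    Equiv.prod_comp ((Equiv.addRight (m : ZMod n)).trans (Equiv.addRight 1)) (quotVar n k)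
  rw [h1, h2]
  exact div_self (Finset.prod_ne_zero_iff.2 fun _ _ => quotVar_ne_zero n k _)

/-! ### Equivariance -/

theorem extendedAction_r_rotVar (c i : ZMod n) :
    extendedAction k _ (.r c) (rotVar n k i) = rotVar n k (i + c) := by
  simp [rotVar, extendedAction_apply_var, add_comm]

theorem extendedAction_r_reflVar (c i : ZMod n) :
    extendedAction k _ (.r c) (reflVar n k i) = reflVar n k (i + c) := by
  simp only [reflVar, extendedAction_apply_var, Option.smul_some, smul_eq_mul,
    DihedralGroup.r_mul_sr]
  ring_nf

theorem extendedAction_sr_rotVar (c i : ZMod n) :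
    extendedAction k _ (.sr c) (rotVar n k i) = reflVar n k (-(i + c)) := by
  simp [rotVar, reflVar, extendedAction_apply_var, add_comm]

theorem extendedAction_sr_reflVar (c i : ZMod n) :
    extendedAction k _ (.sr c) (reflVar n k i) = rotVar n k (-(i + c)) := by
  simp only [rotVar, reflVar, extendedAction_apply_var, Option.smul_some, smul_eq_mul,
    DihedralGroup.sr_mul_sr]
  ring_nf

theorem extendedAction_none (g : DihedralGroup n) :
    extendedAction k _ g (ratVar k none) = ratVar k none := by
  simp [extendedAction_apply_var]

theorem extendedAction_embVar {n m : ℕ} (hnm : n = 2 * m + 1) (g : DihedralGroup n) (i : ZMod n) :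
    extendedAction k _ g (embVar n k m i) = embVar n k m (dihedralPerm n g i) := by
  have h : (2 * m + 1 : ZMod n) = 0 := by
    have := ZMod.natCast_self n
    rw [hnm] at this ⊢
    exact_mod_cast this
  rcases g with c | c
  · have hp : dihedralPerm n (.r c) i = i + c := rfl
    simp only [embVar, quotVar, map_div₀, extendedAction_r_rotVar, extendedAction_r_reflVar, hp]
    ring_nf
  · have hp : dihedralPerm n (.sr c) i = -(i + c) := rfl
    have h1 : -(i + m + 1 + c) = -(i + c) + m := by linear_combination -h
    have h2 : -(i + m + c) = -(i + c) + m + 1 := by linear_combination -h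
    simp only [embVar, quotVar, map_div₀, extendedAction_sr_rotVar, extendedAction_sr_reflVar, hp,
      h1, h2]
    rw [div_div_div_comm, div_div_div_eq, div_div_div_eq, mul_comm (reflVar n k _)]

theorem extendedAction_permVar (m : ℕ) (g : DihedralGroup n) (i : ZMod n) :
    extendedAction k _ g (permVar n k m i) = permVar n k m (dihedralPerm n g i) := by
  rw [permVar, permVar, map_div₀, map_prod, extendedAction_none]
  refine congrArg _ (Finset.prod_congr rfl fun j _ => ?_)
  rcases g with c | c
  · have hp : dihedralPerm n (.r c) i = i + c := rfl
    rw [map_mul, extendedAction_r_rotVar, extendedAction_r_reflVar, hp]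
    ring_nf
  · have hp : dihedralPerm n (.sr c) i = -(i + c) := rfl
    rw [map_mul, extendedAction_sr_rotVar, extendedAction_sr_reflVar, hp, mul_comm]
    ring_nf

/-! ### Monomials in the image of the embedding -/

variable {n k}

/-- A property of residues that holds at `0` and passes from `i` to `i + 1` holds everywhere. -/
theorem ZMod.forall_of_zero_of_succ [NeZero n] {P : ZMod n → Prop} (h0 : P 0)
    (hs : ∀ i, P i → P (i + 1)) (i : ZMod n) : P i := by
  have h : ∀ j : ℕ, P j := fun j => by
    induction j with
    | zero => simpa using h0
    | succ j ih => simpa using hs _ ih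
  simpa using h i.val

/-- The quotients of any two `d_i` lie in the field generated by the images of the `x_i`. -/
theorem quotVar_div_mem [NeZero n] {m : ℕ} {S : IntermediateField k (ExtendedField n k)}
    (hS : ∀ i, embVar n k m i ∈ S) (i j : ZMod n) : quotVar n k i / quotVar n k j ∈ S := by
  have h : ∀ i, quotVar n k i / quotVar n k 0 ∈ S := by
    refine ZMod.forall_of_zero_of_succ ?_ fun i hi => ?_
    · rw [div_self (quotVar_ne_zero n k 0)]
      exact one_mem S
    · have h1 := hS (i - m)
      rw [embVar, sub_add_cancel] at h1
      have h2 := mul_mem h1 hi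
      rwa [div_mul_div_cancel₀ (quotVar_ne_zero n k i)] at h2
  have h1 := div_mem (h i) (h j)
  rwa [div_div_div_cancel_right₀ (quotVar_ne_zero n k 0)] at h1

/-- Passing from `a_i / t_i` to `a_{i+1} / t_{i+1}` multiplies by `d_{i+m+1} / d_i`: both products
telescope, and `i + m + 1 = i - m` modulo `n`. -/
theorem rotVar_div_permVar_succ {m : ℕ} (hnm : n = 2 * m + 1) (i : ZMod n) :
    rotVar n k (i + 1) / permVar n k m (i + 1) =
      quotVar n k (i + m + 1) / quotVar n k i * (rotVar n k i / permVar n k m i) := by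
  have h : (2 * m + 1 : ZMod n) = 0 := by
    have := ZMod.natCast_self n
    rw [hnm] at this ⊢
    exact_mod_cast this
  have hP : rotVar n k (i + 1) * ∏ j ∈ Finset.range m, rotVar n k (i + 1 + (j + 1)) =
      (∏ j ∈ Finset.range m, rotVar n k (i + (j + 1))) * rotVar n k (i + m + 1) := by
    have h1 := Finset.prod_range_succ (fun j : ℕ => rotVar n k (i + (j + 1))) m
    rw [Finset.prod_range_succ', mul_comm] at h1
    simpa [add_assoc, add_comm, add_left_comm] using h1
  have hQ : reflVar n k (i + m + 1) * ∏ j ∈ Finset.range m, reflVar n k (i + 1 - (j + 1)) =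
      (∏ j ∈ Finset.range m, reflVar n k (i - (j + 1))) * reflVar n k i := by
    have h1 := Finset.prod_range_succ' (fun j : ℕ => reflVar n k (i - j)) m
    have h2 : i + m + 1 = i - m := by linear_combination h
    rw [Finset.prod_range_succ, mul_comm] at h1
    simpa [h2] using h1
  simp only [permVar, quotVar, Finset.prod_mul_distrib]
  have ha := rotVar_ne_zero n k
  have hb := reflVar_ne_zero n k
  have hz := ratVar_ne_zero k (none : Option (DihedralGroup n))
  have h1 := ha i
  have h2 := hb i
  have h3 := hb (i + m + 1)
  have h4 : ∏ j ∈ Finset.range m, rotVar n k (i + (j + 1)) ≠ 0 :=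
    Finset.prod_ne_zero_iff.2 fun _ _ => ha _
  have h5 : ∏ j ∈ Finset.range m, reflVar n k (i - (j + 1)) ≠ 0 :=
    Finset.prod_ne_zero_iff.2 fun _ _ => hb _
  have h6 : ∏ j ∈ Finset.range m, rotVar n k (i + 1 + (j + 1)) ≠ 0 :=
    Finset.prod_ne_zero_iff.2 fun _ _ => ha _
  have h7 : ∏ j ∈ Finset.range m, reflVar n k (i + 1 - (j + 1)) ≠ 0 :=
    Finset.prod_ne_zero_iff.2 fun _ _ => hb _
  field_simp
  linear_combination hP * (reflVar n k (i + m + 1) *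
    ∏ j ∈ Finset.range m, reflVar n k (i + 1 - (j + 1))) + hQ *
    (rotVar n k (i + m + 1) * ∏ j ∈ Finset.range m, rotVar n k (i + (j + 1)))

theorem rotVar_div_permVar_mem [NeZero n] {m : ℕ} (hnm : n = 2 * m + 1)
    {S : IntermediateField k (ExtendedField n k)} (hS : ∀ i, embVar n k m i ∈ S) (i : ZMod n) :
    rotVar n k i / permVar n k m i / (rotVar n k 0 / permVar n k m 0) ∈ S := by
  refine ZMod.forall_of_zero_of_succ (P := fun i => rotVar n k i / permVar n k m i /
    (rotVar n k 0 / permVar n k m 0) ∈ S) ?_ (fun i hi => ?_) i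
  · rw [div_self (div_ne_zero (rotVar_ne_zero n k 0) (permVar_ne_zero n k m 0))]
    exact one_mem S
  · rw [rotVar_div_permVar_succ hnm, mul_div_assoc]
    exact mul_mem (quotVar_div_mem hS _ _) hi

theorem reflVar_div_permVar_mem [NeZero n] {m : ℕ} (hnm : n = 2 * m + 1)
    {S : IntermediateField k (ExtendedField n k)} (hS : ∀ i, embVar n k m i ∈ S) (i : ZMod n) :
    reflVar n k i / permVar n k m i / (reflVar n k 0 / permVar n k m 0) ∈ S := by
  have h := mul_mem (rotVar_div_permVar_mem hnm hS i) (quotVar_div_mem hS 0 i)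
  convert h using 1
  simp only [quotVar]
  have h1 := rotVar_ne_zero n k i
  have h2 := rotVar_ne_zero n k 0
  field_simp

variable (n k) in
/-- The generators `t_i` (`i ∈ ℤ/n`), `a_0 / t_0` and `b_0 / t_0` of `k(w_g, z)` over the image of
`k(x_1, …, x_{n-1})`. -/
noncomputable def relGen (m : ℕ) : ZMod n ⊕ Bool → ExtendedField n k
  | .inl i => permVar n k m i
  | .inr true => rotVar n k 0 / permVar n k m 0
  | .inr false => reflVar n k 0 / permVar n k m 0

/-- The images of the `x_i` together with the relative generators generate `k(w_g, z)`. -/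
theorem eq_top_of_embVar_mem_of_relGen_mem [NeZero n] {m : ℕ} (hnm : n = 2 * m + 1)
    {S : IntermediateField k (ExtendedField n k)} (hS : ∀ i, embVar n k m i ∈ S)
    (hT : ∀ q, relGen n k m q ∈ S) : S = ⊤ := by
  have ht : ∀ i, permVar n k m i ∈ S := fun i => hT (.inl i)
  have ha : ∀ i, rotVar n k i ∈ S := fun i => by
    have h := mul_mem (mul_mem (rotVar_div_permVar_mem hnm hS i) (hT (.inr true))) (ht i)
    rwa [relGen, div_mul_cancel₀ _ (div_ne_zero (rotVar_ne_zero n k 0) (permVar_ne_zero n k m 0)),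
      div_mul_cancel₀ _ (permVar_ne_zero n k m i)] at h
  have hb : ∀ i, reflVar n k i ∈ S := fun i => by
    have h := mul_mem (mul_mem (reflVar_div_permVar_mem hnm hS i) (hT (.inr false))) (ht i)
    rwa [relGen, div_mul_cancel₀ _ (div_ne_zero (reflVar_ne_zero n k 0) (permVar_ne_zero n k m 0)),
      div_mul_cancel₀ _ (permVar_ne_zero n k m i)] at h
  rw [eq_top_iff, ← adjoin_ratVar, IntermediateField.adjoin_le_iff]
  rintro _ ⟨_ | g | i, rfl⟩
  · have h := mul_mem (ht 0) (prod_mem (t := Finset.range m) fun j _ =>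
      mul_mem (ha (0 + (j + 1))) (hb (0 - (j + 1))))
    rwa [permVar, div_mul_cancel₀ _ (prod_rotVar_mul_reflVar_ne_zero n k m 0)] at h
  · exact ha g
  · have := hb (-i)
    rwa [reflVar, neg_neg] at this

/-- Reflections exchange `a_0 / t_0` and `b_0 / t_0`, and rotations fix them, up to factors from the
image of `k(x_1, …, x_{n-1})`. -/
theorem exists_extendedAction_relGen [NeZero n] {m : ℕ} (hnm : n = 2 * m + 1)
    {S : IntermediateField k (ExtendedField n k)} (hS : ∀ i, embVar n k m i ∈ S)
    (g : DihedralGroup n) (q : ZMod n ⊕ Bool) :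
    ∃ a ∈ S, ∃ q', extendedAction k _ g (relGen n k m q) = a * relGen n k m q' := by
  have h1 : ∀ i, ∃ a ∈ S, ∃ q', rotVar n k i / permVar n k m i = a * relGen n k m q' := fun i =>
    ⟨_, rotVar_div_permVar_mem hnm hS i, .inr true, (div_mul_cancel₀ _
      (div_ne_zero (rotVar_ne_zero n k 0) (permVar_ne_zero n k m 0))).symm⟩
  have h2 : ∀ i, ∃ a ∈ S, ∃ q', reflVar n k i / permVar n k m i = a * relGen n k m q' := fun i =>
    ⟨_, reflVar_div_permVar_mem hnm hS i, .inr false, (div_mul_cancel₀ _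
      (div_ne_zero (reflVar_ne_zero n k 0) (permVar_ne_zero n k m 0))).symm⟩
  rcases q with i | _ | _
  · exact ⟨1, one_mem S, .inl (dihedralPerm n g i), by
      rw [relGen, extendedAction_permVar, one_mul, relGen]⟩
  · rw [relGen, map_div₀, extendedAction_permVar]
    rcases g with c | c
    · rw [extendedAction_r_reflVar]; exact h2 _
    · rw [extendedAction_sr_reflVar]; exact h1 _
  · rw [relGen, map_div₀, extendedAction_permVar]
    rcases g with c | c
    · rw [extendedAction_r_rotVar]; exact h1 _
    · rw [extendedAction_sr_rotVar]; exact h2 _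

/-- The element of index `0` is the inverse of the product of the others, as in `dihedralVar`. -/
theorem embVar_mem_of_ne_zero [NeZero n] {m : ℕ} {S : IntermediateField k (ExtendedField n k)}
    (hS : ∀ i : {i : ZMod n // i ≠ 0}, embVar n k m i ∈ S) (i : ZMod n) : embVar n k m i ∈ S := by
  by_cases hi : i = 0
  · subst hi
    have h := prod_embVar n k m
    rw [Fintype.prod_eq_mul_prod_subtype_ne _ (0 : ZMod n)] at h
    rw [eq_inv_of_mul_eq_one_left h]
    exact inv_mem (prod_mem fun j _ => hS j)
  · exact hS ⟨i, hi⟩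

theorem card_ne_zero_add_card [NeZero n] :
    Nat.card {i : ZMod n // i ≠ 0} + Nat.card (ZMod n ⊕ Bool) =
      Nat.card (Option (DihedralGroup n)) := by
  have h : Fintype.card {i : ZMod n // i ≠ 0} = n - 1 := by
    rw [Fintype.card_subtype_compl, Fintype.card_subtype_eq, ZMod.card]
  have hn := NeZero.pos n
  rw [Nat.card_eq_fintype_card, h, Nat.card_sum, Finite.card_option, DihedralGroup.nat_card,
    Nat.card_zmod, Nat.card_eq_fintype_card, Fintype.card_bool]
  omega

theorem algebraicIndependent_embVar [NeZero n] {m : ℕ} (hnm : n = 2 * m + 1) :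
    AlgebraicIndependent k (fun i : {i : ZMod n // i ≠ 0} => embVar n k m i) := by
  obtain ⟨y, hy⟩ : ∃ y, y = Sum.elim (fun i : {i : ZMod n // i ≠ 0} => embVar n k m i)
    (relGen n k m) := ⟨_, rfl⟩
  have hmem : ∀ q, y q ∈ IntermediateField.adjoin k (Set.range y) := fun q =>
    IntermediateField.subset_adjoin k _ (Set.mem_range_self q)
  have htop : IntermediateField.adjoin k (Set.range y) = ⊤ := by
    refine eq_top_of_embVar_mem_of_relGen_mem hnm (embVar_mem_of_ne_zero fun i => ?_) fun q => ?_
    · have := hmem (.inl i)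
      rwa [hy] at this ⊢
    · have := hmem (.inr q)
      rwa [hy] at this ⊢
  have h : AlgebraicIndependent k y := algebraicIndependent_of_card_le_trdeg htop <| by
    rw [trdeg_rationalFunctionField, Nat.card_sum, card_ne_zero_add_card]
  have h1 := h.comp Sum.inl Sum.inl_injective
  rw [hy] at h1
  exact h1

/-- `k(w_g, z)^{D_n}` is purely transcendental over `k(x_1, …, x_{n-1})^{D_n}`, with `n + 2`
generators. -/
theorem nonempty_algEquiv_dihedralFixedField (k : Type*) [Field k] {n m : ℕ} [NeZero n]
    (hn : 3 ≤ n) (hnm : n = 2 * m + 1) :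
    Nonempty (RationalFunctionField (ZMod n ⊕ Bool) (dihedralFixedField n k) ≃ₐ[k]
      IntermediateField.fixedField (extendedAction k (DihedralGroup n)).range) := by
  set φ := ratFunHom (algebraicIndependent_embVar (k := k) hnm)
  have hφ0 : ∀ i : {i : ZMod n // i ≠ 0}, embVar n k m i = φ (dihedralVar n k i) := fun i => by
    rw [dihedralVar_of_ne, ratFunHom_ratVar]
  have hφ : ∀ i, embVar n k m i = φ (dihedralVar n k i) := fun i => by
    by_cases hi : i = 0
    · subst hi
      have h := prod_embVar n k m
      have h' := congrArg φ (prod_dihedralVar n k)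
      rw [Fintype.prod_eq_mul_prod_subtype_ne _ (0 : ZMod n)] at h h'
      rw [map_mul, map_prod, map_one] at h'
      simp only [hφ0] at h
      rw [eq_inv_of_mul_eq_one_left h, eq_inv_of_mul_eq_one_left h']
    · exact hφ0 ⟨i, hi⟩
  have hS : ∀ i, embVar n k m i ∈ φ.fieldRange := fun i => ⟨_, (hφ i).symm⟩
  refine nonempty_algEquiv_fixedField_of_monomial φ (ρ := dihedralAction n k)
    (t := relGen n k m) (dihedralAction_injective hn k) (fun g a => ?_) (fun S h1 h2 => ?_)
    (trdeg_rationalFunctionField _ k)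
    ((trdeg_rationalFunctionField _ k).trans (by rw [card_ne_zero_add_card])) (fun g q => ?_)
  · have : (extendedAction k _ g : _ →ₐ[k] _).comp φ =
        φ.comp (dihedralAction n k g : _ →ₐ[k] _) := ratVar_algHom_ext fun i => by
      rw [← dihedralVar_of_ne]
      change extendedAction k _ g (φ _) = φ (permHom n k (dihedralPerm n g) _)
      rw [permHom_apply_var, ← hφ, ← hφ, extendedAction_embVar k hnm]
    exact DFunLike.congr_fun this a
  · exact eq_top_of_embVar_mem_of_relGen_mem hnm (fun i => hφ i ▸ h1 _) h2
  · obtain ⟨_, ⟨a, rfl⟩, q', h⟩ := exists_extendedAction_relGen hnm hS g q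
    exact ⟨a, q', h⟩

end Embedding

theorem theorem5p6 (k : Type*) [Field k] (n : ℕ) [NeZero n] (hn : 3 ≤ n) (hodd : Odd n) :
    IsStablyRationalField k (dihedralFixedField n k) ↔
      IsStablyRationalField k (noetherField k (DihedralGroup n)) := by
  obtain ⟨m, hnm⟩ := hodd
  obtain ⟨e⟩ := nonempty_algEquiv_dihedralFixedField k hn hnm
  obtain ⟨f⟩ := nonempty_algEquiv_noetherField k (DihedralGroup n)
  rw [← isStablyRationalField_ratFun_iff (k := k) (L := dihedralFixedField n k)
      (ι := ZMod n ⊕ Bool),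
    ← isStablyRationalField_ratFun_iff (k := k) (L := noetherField k (DihedralGroup n))
      (ι := Unit)]
  exact ⟨.of_algEquiv (e.trans f.symm), .of_algEquiv (f.trans e.symm)⟩
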